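/- Let $q \ge 1$ be a fixed integer (not depending on $n$), and let $(K_n)$ and $(P_n)$ be sequences of natural numbers. Let $G_q(n,K_n,P_n)$ be the random graph on $n$ nodes in which each node is independently assigned a set of $K_n$ distinct keys, chosen uniformly at random among all $K_n$-element subsets of a pool of $P_n$ keys, and two distinct nodes are adjacent if and only if their key sets have at least $q$ keys in common. (This is the secure sensor network with the $q$-composite key predistribution scheme under full visibility.) Suppose that, as $n\to\infty$, $$K_n=\omega(\ln n)\qquad\text{and}\qquad K_n = o\!\left(\min\left\{\sqrt{P_n},\ \frac{P_n}{n}\right\}\right),$$ and that there is a constant $c>1$ such that $$\frac{1}{q!}\cdot\frac{K_n^{2q}}{P_n^{q}}\ \ge\ \frac{c\ln n}{n}\qquad\text{for all sufficiently large } n.$$ Then $G_q(n,K_n,P_n)$ is connected with high probability, that is, $\lim_{n\to\infty}\mathbb{P}\left[G_q(n,K_n,P_n)\text{ is connected}\right]=1$. -/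

import Mathlib

open Filter Topology MeasureTheory ProbabilityTheory Asymptotics

/-- The law of one key ring: the uniform distribution on the sets of exactly `K` distinct keys
from a pool of `P` keys. (It is the zero measure if `P < K`, when there is no such set.) -/
noncomputable def keyRingLaw (K P : ℕ) : Measure (Finset (Fin P)) :=
  uniformOn {S : Finset (Fin P) | S.card = K}

/-- The joint law of the key rings of `n` nodes: independent, each with law `keyRingLaw K P`. -/
noncomputable def keyAssignmentLaw (n K P : ℕ) : Measure (Fin n → Finset (Fin P)) :=
  Measure.pi fun _ : Fin n => keyRingLaw K P

/-- The `q`-composite intersection graph of a key assignment: two distinct nodes are adjacent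
if and only if they have at least `q` keys in common. -/
def qCompositeGraph (q : ℕ) {n P : ℕ} (S : Fin n → Finset (Fin P)) : SimpleGraph (Fin n) where
  Adj i j := i ≠ j ∧ q ≤ (S i ∩ S j).card
  symm := ⟨fun i j h => ⟨h.1.symm, by simpa only [Finset.inter_comm] using h.2⟩⟩
  loopless := ⟨fun _ h => h.1 rfl⟩

/-- The probability that the random graph `G_q(n, K, P)` is connected. -/
noncomputable def connectedProb (q n K P : ℕ) : ℝ :=
  (keyAssignmentLaw n K P).real {S | (qCompositeGraph q S).Connected}

/-!
Replace every key ring by a Bernoulli subset of the pool with inclusion probability `t K / P`,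
where `t < 1` is close to `1`, and discard the assignments in which some ring has more than `K`
keys. By a Chernoff bound this costs little because `K` is much larger than `log n`. What is left
is stochastically dominated by the uniform rings of size `K`, and connectivity is monotone in the
rings, so it suffices to bound the probability that the Bernoulli graph is disconnected.

In the Bernoulli model the roles of nodes and keys can be exchanged: the sets of nodes holding the
individual keys are independent. A cut `(T, Tᶜ)` is empty only if each of its `#T * #Tᶜ` pairs
shares fewer than `q` keys. A given key is held by exactly the two nodes of a pair with probability
`p = x² (1 - x) ^ (n - 2)`, `x = t K / P`, and for different pairs these events are disjoint; such
disjoint events are negatively dependent, so the cut is empty with probability at most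
`Bin(P, p) {0, …, q - 1} ^ (#T * #Tᶜ)`. As `Bin(P, p) {0, …, q - 1}` is at most
`exp (-a log n / n)` with some `a > 1`, the union bound over all cuts is the one of the Erdős–Rényi
graph above its connectivity threshold.
-/

open Finset
open scoped BigOperators unitInterval

section IIDMean

variable {ι Ω : Type*} [Fintype ι] [DecidableEq ι] [Fintype Ω] {w : Ω → ℝ}

/-- The expectation of `f` under independent draws of all coordinates, each of them according to the
weights `w`. The weights need not sum to one, so that truncated laws are included. -/
noncomputable def iidMean (w : Ω → ℝ) (f : (ι → Ω) → ℝ) : ℝ :=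
  ∑ S, (∏ i, w (S i)) * f S

theorem iidMean_mono (hw : 0 ≤ w) {f g : (ι → Ω) → ℝ} (hfg : f ≤ g) :
    iidMean w f ≤ iidMean w g :=
  sum_le_sum fun S _ => mul_le_mul_of_nonneg_left (hfg S) (prod_nonneg fun i _ => hw (S i))

theorem iidMean_nonneg (hw : 0 ≤ w) {f : (ι → Ω) → ℝ} (hf : 0 ≤ f) : 0 ≤ iidMean w f :=
  sum_nonneg fun S _ => mul_nonneg (prod_nonneg fun i _ => hw (S i)) (hf S)

theorem iidMean_sub (w : Ω → ℝ) (f g : (ι → Ω) → ℝ) :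
    iidMean w (fun S => f S - g S) = iidMean w f - iidMean w g := by
  simp only [iidMean, mul_sub, sum_sub_distrib]

theorem iidMean_sum {κ : Type*} (w : Ω → ℝ) (s : Finset κ) (f : κ → (ι → Ω) → ℝ) :
    iidMean w (fun S => ∑ k ∈ s, f k S) = ∑ k ∈ s, iidMean w (f k) := by
  simp only [iidMean, mul_sum]
  exact sum_comm

theorem iidMean_prod (w : Ω → ℝ) (g : ι → Ω → ℝ) :
    iidMean w (fun S => ∏ i, g i (S i)) = ∏ i, ∑ s, w s * g i s := by
  simp only [iidMean, ← prod_mul_distrib]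
  rw [prod_univ_sum, Fintype.piFinset_univ]

theorem iidMean_one (hw : ∑ s, w s = 1) : iidMean w (fun _ : ι → Ω => 1) = 1 := by
  simpa [hw] using iidMean_prod w fun (_ : ι) _ => 1

theorem iidMean_eval (hw : ∑ s, w s = 1) (g : Ω → ℝ) (i : ι) :
    iidMean w (fun S : ι → Ω => g (S i)) = ∑ s, w s * g s := by
  have h := iidMean_prod w (Function.update (fun _ _ => 1) i g)
  rw [← mul_prod_erase _ _ (mem_univ i), prod_eq_one (s := univ.erase i)] at h
  · rw [Function.update_self, mul_one] at h
    rw [← h]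
    congr! 2 with S
    rw [← mul_prod_erase _ _ (mem_univ i), prod_eq_one, Function.update_self, mul_one]
    intro j hj
    rw [Function.update_of_ne (ne_of_mem_erase hj)]
  · intro j hj
    simp [Function.update_of_ne (ne_of_mem_erase hj), hw]

theorem iidMean_ite_zero (w : Ω → ℝ) (p : Ω → Prop) [DecidablePred p]
    [∀ S : ι → Ω, Decidable (∀ i, p (S i))] (f : (ι → Ω) → ℝ) :
    iidMean (fun s => if p s then w s else 0) f =
      iidMean w (fun S => if ∀ i, p (S i) then f S else 0) := by
  refine sum_congr rfl fun S _ => ?_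
  simp [prod_ite_zero]

theorem iidMean_cons {n : ℕ} (w : Ω → ℝ) (f : (Fin (n + 1) → Ω) → ℝ) :
    iidMean w f = ∑ s, w s * iidMean w fun S : Fin n → Ω => f (Fin.cons s S) := by
  simp only [iidMean, mul_sum]
  rw [← (Fin.consEquiv fun _ : Fin (n + 1) => Ω).sum_comp, Fintype.sum_prod_type]
  simp [Fin.consEquiv, Fin.prod_univ_succ, mul_assoc]

end IIDMean

section StochasticDomination

variable {Ω : Type*} [Fintype Ω] [Preorder Ω] {a w : Ω → ℝ}

/-- Stochastic domination of the weights `a` by the weights `w`. Only nonnegative functions are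
tested, so that the total weight of `a` may be smaller than that of `w`. -/
def StochDominated (a w : Ω → ℝ) : Prop :=
  ∀ g : Ω → ℝ, Monotone g → 0 ≤ g → ∑ s, a s * g s ≤ ∑ s, w s * g s

theorem StochDominated.iidMean_le (h : StochDominated a w) (ha : 0 ≤ a) (hw : 0 ≤ w) {n : ℕ}
    {f : (Fin n → Ω) → ℝ} (hf : Monotone f) (hf0 : 0 ≤ f) : iidMean a f ≤ iidMean w f := by
  induction n with
  | zero => simp [iidMean]
  | succ n ih =>
    rw [iidMean_cons, iidMean_cons]
    calc ∑ s, a s * iidMean a (fun S : Fin n → Ω => f (Fin.cons s S))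
        ≤ ∑ s, a s * iidMean w (fun S : Fin n → Ω => f (Fin.cons s S)) :=
          sum_le_sum fun s _ => mul_le_mul_of_nonneg_left
            (ih (fun S S' hS => hf (Fin.cons_le_cons.2 ⟨le_rfl, hS⟩)) fun S => hf0 _) (ha s)
      _ ≤ ∑ s, w s * iidMean w (fun S : Fin n → Ω => f (Fin.cons s S)) :=
          h _ (fun s s' hs => iidMean_mono hw fun S => hf (Fin.cons_le_cons.2 ⟨hs, le_rfl⟩))
            fun s => iidMean_nonneg hw fun S => hf0 _

end StochasticDomination

section RandomFinset

variable {α : Type*} [Fintype α]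

/-- The probability that the random subset of `α` containing each element independently with
probability `x` equals `S`: the singleton probabilities of `setBernoulli`, on `Finset α`. -/
noncomputable def bernoulliWeight (x : I) (S : Finset α) : ℝ :=
  x ^ #S * (1 - x) ^ (Fintype.card α - #S)

/-- The probability that a uniformly random subset of `α` with `K` elements equals `S`. -/
noncomputable def uniformWeight (K : ℕ) (S : Finset α) : ℝ :=
  if #S = K then ((Fintype.card α).choose K : ℝ)⁻¹ else 0

theorem bernoulliWeight_nonneg (x : I) : 0 ≤ (bernoulliWeight x : Finset α → ℝ) := fun _ =>
  mul_nonneg (pow_nonneg x.2.1 _) (pow_nonneg (sub_nonneg.2 x.2.2) _)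

theorem uniformWeight_nonneg (K : ℕ) : 0 ≤ (uniformWeight K : Finset α → ℝ) := by
  intro S
  unfold uniformWeight
  split_ifs <;> positivity

theorem bernoulliWeight_eq_prod [DecidableEq α] (x : I) (S : Finset α) :
    bernoulliWeight x S = ∏ k, if k ∈ S then (x : ℝ) else 1 - x := by
  rw [prod_ite, prod_const, prod_const, filter_mem_eq_inter, univ_inter, filter_notMem_eq_sdiff,
    ← compl_eq_univ_sdiff, card_compl, bernoulliWeight]

theorem sum_bernoulliWeight_mul_pow_card (x : I) (a : ℝ) :
    ∑ S : Finset α, bernoulliWeight x S * a ^ #S = (x * a + (1 - x)) ^ Fintype.card α := by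
  rw [← Fintype.sum_pow_mul_eq_add_pow]
  refine sum_congr rfl fun S _ => ?_
  rw [bernoulliWeight, mul_pow]
  ring

theorem sum_bernoulliWeight (x : I) : ∑ S : Finset α, bernoulliWeight x S = 1 := by
  simpa using sum_bernoulliWeight_mul_pow_card (α := α) x 1

theorem sum_bernoulliWeight_card_gt_le_exp (x : I) {l : ℝ} (hl : 0 ≤ l) (K : ℕ) :
    ∑ S : Finset α with K < #S, bernoulliWeight x S ≤
      Real.exp (Fintype.card α * x * (Real.exp l - 1) - l * K) := by
  have markov (S : Finset α) (hS : K < #S) : 1 ≤ Real.exp (-(l * K)) * Real.exp l ^ #S := by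
    rw [← Real.exp_nat_mul, ← Real.exp_add, Real.one_le_exp_iff]
    have : (K : ℝ) ≤ #S := by exact_mod_cast hS.le
    nlinarith
  calc ∑ S : Finset α with K < #S, bernoulliWeight x S
      ≤ ∑ S : Finset α with K < #S,
          Real.exp (-(l * K)) * (bernoulliWeight x S * Real.exp l ^ #S) := by
        refine sum_le_sum fun S hS => ?_
        rw [mul_left_comm]
        exact le_mul_of_one_le_right (bernoulliWeight_nonneg x S) (markov S (mem_filter.1 hS).2)
    _ ≤ ∑ S : Finset α, Real.exp (-(l * K)) * (bernoulliWeight x S * Real.exp l ^ #S) :=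
        sum_le_sum_of_subset_of_nonneg (filter_subset _ _) fun S _ _ =>
          mul_nonneg (Real.exp_pos _).le
            (mul_nonneg (bernoulliWeight_nonneg x S) (pow_nonneg (Real.exp_pos _).le _))
    _ = Real.exp (-(l * K)) * (x * (Real.exp l - 1) + 1) ^ Fintype.card α := by
        rw [← mul_sum, sum_bernoulliWeight_mul_pow_card]
        ring_nf
    _ ≤ Real.exp (-(l * K)) * Real.exp (x * (Real.exp l - 1)) ^ Fintype.card α := by
        have : 0 ≤ x * (Real.exp l - 1) := mul_nonneg x.2.1 (sub_nonneg.2 (Real.one_le_exp hl))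
        gcongr
        exact Real.add_one_le_exp _
    _ = Real.exp (Fintype.card α * x * (Real.exp l - 1) - l * K) := by
        rw [← Real.exp_nat_mul, ← Real.exp_add]
        ring_nf

/- `l = (1 - t) / 2` is the first-order approximation of half of the optimal exponent
`log (1 / t)`. -/
theorem sum_bernoulliWeight_card_gt_le_exp_of_mean {x : I} {t : ℝ} (ht0 : 0 ≤ t) (ht1 : t ≤ 1)
    {K : ℕ} (hx : Fintype.card α * (x : ℝ) = t * K) :
    ∑ S : Finset α with K < #S, bernoulliWeight x S ≤ Real.exp (-((1 - t) ^ 2 / 4 * K)) := by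
  have hl : 0 ≤ (1 - t) / 2 := by linarith
  refine (sum_bernoulliWeight_card_gt_le_exp x hl K).trans (Real.exp_le_exp.2 ?_)
  have hexp : Real.exp ((1 - t) / 2) - 1 - (1 - t) / 2 ≤ ((1 - t) / 2) ^ 2 :=
    (le_abs_self _).trans
      (Real.abs_exp_sub_one_sub_id_le (by rw [abs_of_nonneg hl]; linarith))
  have hrate : t * (Real.exp ((1 - t) / 2) - 1) - (1 - t) / 2 ≤ -((1 - t) ^ 2 / 4) := by
    nlinarith [mul_le_mul_of_nonneg_left hexp ht0, sq_nonneg (1 - t)]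
  rw [hx]
  nlinarith [mul_le_mul_of_nonneg_right hrate K.cast_nonneg]

theorem choose_mul_sum_powersetCard_le_of_monotone {g : Finset α → ℝ}
    (hg : Monotone g) {m K : ℕ} (hmK : m ≤ K) :
    ((Fintype.card α - m).choose (K - m) : ℝ) * ∑ A ∈ powersetCard m univ, g A ≤
      K.choose m * ∑ B ∈ powersetCard K univ, g B := by
  classical
  calc ((Fintype.card α - m).choose (K - m) : ℝ) * ∑ A ∈ powersetCard m univ, g A
      = ∑ A ∈ powersetCard m univ, ∑ _B ∈ powersetCard K univ with A ⊆ _B, g A := by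
        rw [mul_sum]
        refine sum_congr rfl fun A hA => ?_
        rw [mem_powersetCard_univ] at hA
        rw [sum_const, card_filter_powersetCard_subset A univ K (subset_univ A) (hA ▸ hmK), hA,
          card_univ, nsmul_eq_mul]
    _ ≤ ∑ A ∈ powersetCard m univ, ∑ B ∈ powersetCard K univ with A ⊆ B, g B :=
        sum_le_sum fun A _ => sum_le_sum fun B hB => hg (mem_filter.1 hB).2
    _ = ∑ B ∈ powersetCard K univ, ∑ _A ∈ powersetCard m B, g B :=
        sum_comm' fun A B => by simp only [mem_filter, mem_powersetCard, subset_univ]; tauto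
    _ = K.choose m * ∑ B ∈ powersetCard K univ, g B := by
        rw [mul_sum]
        refine sum_congr rfl fun B hB => ?_
        rw [sum_const, card_powersetCard, mem_powersetCard_univ.1 hB, nsmul_eq_mul]

theorem expect_powersetCard_le_of_monotone {g : Finset α → ℝ} (hg : Monotone g) {m K : ℕ}
    (hmK : m ≤ K) (hK : K ≤ Fintype.card α) :
    𝔼 A ∈ powersetCard m univ, g A ≤ 𝔼 B ∈ powersetCard K univ, g B := by
  have hcount := choose_mul_sum_powersetCard_le_of_monotone hg hmK
  have hchoose : ((Fintype.card α).choose K : ℝ) * K.choose m =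
      (Fintype.card α).choose m * (Fintype.card α - m).choose (K - m) := by
    exact_mod_cast Nat.choose_mul hmK
  have hm : (0 : ℝ) < (Fintype.card α).choose m := by
    exact_mod_cast Nat.choose_pos (hmK.trans hK)
  have hKm : (0 : ℝ) < K.choose m := by exact_mod_cast Nat.choose_pos hmK
  have hK' : (0 : ℝ) < (Fintype.card α).choose K := by exact_mod_cast Nat.choose_pos hK
  simp only [expect_eq_sum_div_card, card_powersetCard, card_univ]
  rw [div_le_div_iff₀ hm hK', ← mul_le_mul_iff_left₀ hKm]
  linear_combination ((Fintype.card α).choose m : ℝ) * hcount +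
    (∑ A ∈ powersetCard m univ, g A) * hchoose

theorem sum_card_mul_eq_sum_choose_mul_expect (h : ℕ → ℝ) (g : Finset α → ℝ) :
    ∑ S, h #S * g S = ∑ m ∈ range (Fintype.card α + 1),
      (Fintype.card α).choose m * h m * 𝔼 S ∈ powersetCard m univ, g S := by
  rw [← powerset_univ, sum_powerset, card_univ]
  refine sum_congr rfl fun m _ => ?_
  calc ∑ S ∈ powersetCard m univ, h #S * g S = h m * ∑ S ∈ powersetCard m univ, g S := by
        rw [mul_sum]
        exact sum_congr rfl fun S hS => by rw [mem_powersetCard_univ.1 hS]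
    _ = (Fintype.card α).choose m * h m * 𝔼 S ∈ powersetCard m univ, g S := by
        rw [← card_mul_expect, card_powersetCard, card_univ]
        ring

theorem sum_uniformWeight_mul (K : ℕ) (g : Finset α → ℝ) :
    ∑ S, uniformWeight K S * g S = 𝔼 S ∈ powersetCard K univ, g S := by
  simp only [uniformWeight, ite_mul, zero_mul]
  rw [← sum_filter, ← powerset_univ, ← powersetCard_eq_filter, ← mul_sum, expect_eq_sum_div_card,
    card_powersetCard, card_univ, inv_mul_eq_div]

theorem stochDominated_bernoulliWeight_uniformWeight (x : I) {K : ℕ} (hK : K ≤ Fintype.card α) :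
    StochDominated (fun S : Finset α => if #S ≤ K then bernoulliWeight x S else 0)
      (uniformWeight K) := by
  intro g hg hg0
  set b : ℕ → ℝ := fun m => x ^ m * (1 - x) ^ (Fintype.card α - m)
  have hb (m : ℕ) : 0 ≤ b m :=
    mul_nonneg (pow_nonneg x.2.1 _) (pow_nonneg (sub_nonneg.2 x.2.2) _)
  have hexpect (m : ℕ) : 0 ≤ 𝔼 S ∈ powersetCard m univ, g S := expect_nonneg fun S _ => hg0 S
  have hterm (m : ℕ) :
      (Fintype.card α).choose m * (if m ≤ K then b m else 0) *
        𝔼 S ∈ powersetCard m univ, g S ≤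
      (Fintype.card α).choose m * b m * 𝔼 S ∈ powersetCard K univ, g S := by
    have hbin : 0 ≤ (Fintype.card α).choose m * b m := mul_nonneg (Nat.cast_nonneg _) (hb m)
    split_ifs with hmK
    · exact mul_le_mul_of_nonneg_left (expect_powersetCard_le_of_monotone hg hmK hK) hbin
    · simpa using mul_nonneg hbin (hexpect K)
  have htotal : ∑ m ∈ range (Fintype.card α + 1), (Fintype.card α).choose m * b m = 1 := by
    simpa [b, mul_comm] using (add_pow (x : ℝ) (1 - x) (Fintype.card α)).symm
  calc ∑ S, (if #S ≤ K then bernoulliWeight x S else 0) * g S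
      = ∑ m ∈ range (Fintype.card α + 1), (Fintype.card α).choose m * (if m ≤ K then b m else 0) *
          𝔼 S ∈ powersetCard m univ, g S :=
        sum_card_mul_eq_sum_choose_mul_expect (fun m => if m ≤ K then b m else 0) g
    _ ≤ ∑ m ∈ range (Fintype.card α + 1),
          (Fintype.card α).choose m * b m * 𝔼 S ∈ powersetCard K univ, g S :=
        sum_le_sum fun m _ => hterm m
    _ = ∑ S, uniformWeight K S * g S := by
        rw [← sum_mul, htotal, one_mul, sum_uniformWeight_mul]

end RandomFinset

section BinomialTail

variable {p : I}

theorem binomial_real_Iio_succ (N d : ℕ) :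
    Bin(N, p).real (Set.Iio (d + 1)) = Bin(N, p).real (Set.Iio d) + Bin(N, p).real {d} := by
  rw [Set.Iio_add_one_eq_Iic, ← Set.Iio_insert, Set.insert_eq, Set.union_comm,
    measureReal_union (by simp) (measurableSet_singleton d)]

theorem binomial_succ_real_singleton_succ (N d : ℕ) :
    Bin(N + 1, p).real {d + 1} = (1 - p) * Bin(N, p).real {d + 1} + p * Bin(N, p).real {d} := by
  simp only [binomial_real_singleton, Nat.add_sub_add_right]
  rw [Nat.choose_succ_succ, Nat.cast_add]
  obtain hd | hd := le_or_gt (d + 1) N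
  · rw [show N - d = N - (d + 1) + 1 by omega]
    ring
  · rw [Nat.choose_eq_zero_of_lt hd]
    ring

theorem binomial_succ_real_Iio (N d : ℕ) :
    Bin(N + 1, p).real (Set.Iio d) =
      (1 - p) * Bin(N, p).real (Set.Iio d) + p * Bin(N, p).real (Set.Iio (d - 1)) := by
  induction d with
  | zero => simp
  | succ d ih =>
    rw [binomial_real_Iio_succ, binomial_real_Iio_succ, ih]
    cases d with
    | zero =>
      simp
      ring
    | succ d =>
      rw [binomial_succ_real_singleton_succ, add_tsub_cancel_right, add_tsub_cancel_right,
        binomial_real_Iio_succ]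
      ring

theorem binomial_real_Iio_le (N d : ℕ) :
    Bin(N, p).real (Set.Iio d) ≤ 1 - N.choose d * p ^ d * (1 - p) ^ (N - d) := by
  rw [← binomial_real_singleton, le_sub_iff_add_le, ← binomial_real_Iio_succ]
  exact measureReal_le_one

end BinomialTail

section NegativeDependence

theorem one_sub_sum_le_prod_one_sub {ι : Type*} {s : Finset ι} {f : ι → ℝ}
    (h0 : ∀ i ∈ s, 0 ≤ f i) (h1 : ∀ i ∈ s, f i ≤ 1) :
    1 - ∑ i ∈ s, f i ≤ ∏ i ∈ s, (1 - f i) := by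
  classical
  induction s using Finset.induction_on with
  | empty => simp
  | insert a s ha ih =>
    rw [forall_mem_insert] at h0 h1
    rw [sum_insert ha, prod_insert ha]
    have hprod : ∏ i ∈ s, (1 - f i) ≤ 1 :=
      prod_le_one (fun i hi => sub_nonneg.2 (h1.2 i hi)) fun i hi => sub_le_self _ (h0.2 i hi)
    nlinarith [ih h0.2 h1.2]

variable {Ω ι : Type*} [Fintype Ω] {μ : Ω → ℝ} {E : Finset ι} {p : I} {v : ι → Ω}
  {hit : Ω → ι → Prop} [∀ w e, Decidable (hit w e)]

/- The outcomes `v e` are distinct, so the losses `r e` they cause add up, and the sum of the losses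
is at least the loss `1 - ∏ (1 - p * r e)` of independent trials. -/
theorem sum_mul_prod_ite_one_sub_le (hμ : 0 ≤ μ) (hμ1 : ∑ w, μ w = 1) (hv : Set.InjOn v E)
    (hvp : ∀ e ∈ E, (p : ℝ) ≤ μ (v e)) (hvh : ∀ e ∈ E, hit (v e) e) {r : ι → ℝ}
    (hr0 : 0 ≤ r) (hr1 : r ≤ 1) :
    ∑ w, μ w * ∏ e ∈ E, (if hit w e then 1 - r e else 1) ≤ ∏ e ∈ E, (1 - p * r e) := by
  classical
  set Y : Ω → ℝ := fun w => ∏ e ∈ E, if hit w e then 1 - r e else 1 with hY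
  have hfactor0 (w : Ω) (e : ι) : 0 ≤ if hit w e then 1 - r e else 1 := by
    split_ifs <;> linarith [hr1 e, Pi.one_apply (M := fun _ : ι => ℝ) e]
  have hfactor1 (w : Ω) (e : ι) : (if hit w e then 1 - r e else 1) ≤ 1 := by
    split_ifs <;> linarith [hr0 e, Pi.zero_apply (M := fun _ : ι => ℝ) e]
  have hY1 (w : Ω) : Y w ≤ 1 := prod_le_one (fun e _ => hfactor0 w e) fun e _ => hfactor1 w e
  have hYv (e : ι) (he : e ∈ E) : Y (v e) ≤ 1 - r e := by
    simp only [hY]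
    rw [← mul_prod_erase E _ he, if_pos (hvh e he)]
    exact mul_le_of_le_one_right (sub_nonneg.2 (hr1 e))
      (prod_le_one (fun e _ => hfactor0 _ e) fun e _ => hfactor1 _ e)
  have hloss : ∑ e ∈ E, p * r e ≤ 1 - ∑ w, μ w * Y w :=
    calc ∑ e ∈ E, p * r e ≤ ∑ e ∈ E, μ (v e) * (1 - Y (v e)) :=
          sum_le_sum fun e he =>
            mul_le_mul (hvp e he) (by linarith [hYv e he]) (hr0 e) (hμ _)
      _ = ∑ w ∈ E.image v, μ w * (1 - Y w) :=
          (sum_image (f := fun w => μ w * (1 - Y w)) hv).symm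
      _ ≤ ∑ w, μ w * (1 - Y w) :=
          sum_le_sum_of_subset_of_nonneg (subset_univ _) fun w _ _ =>
            mul_nonneg (hμ w) (sub_nonneg.2 (hY1 w))
      _ = 1 - ∑ w, μ w * Y w := by simp only [mul_sub, sum_sub_distrib, mul_one, hμ1]
  calc ∑ w, μ w * Y w ≤ 1 - ∑ e ∈ E, p * r e := by linarith
    _ ≤ ∏ e ∈ E, (1 - p * r e) :=
        one_sub_sum_le_prod_one_sub (fun e _ => mul_nonneg p.2.1 (hr0 e))
          fun e _ => mul_le_one₀ p.2.2 (hr0 e) (hr1 e)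

theorem sum_mul_prod_ite_le (hμ : 0 ≤ μ) (hμ1 : ∑ w, μ w = 1) (hv : Set.InjOn v E)
    (hvp : ∀ e ∈ E, (p : ℝ) ≤ μ (v e)) (hvh : ∀ e ∈ E, hit (v e) e) {x y : ι → ℝ}
    (hy : 0 ≤ y) (hyx : y ≤ x) :
    ∑ w, μ w * ∏ e ∈ E, (if hit w e then y e else x e) ≤
      ∏ e ∈ E, ((1 - p) * x e + p * y e) := by
  have hx : 0 ≤ x := hy.trans hyx
  have hcancel (e : ι) : x e * (y e / x e) = y e :=
    mul_div_cancel_of_imp' fun h => le_antisymm (h ▸ hyx e) (hy e)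
  calc ∑ w, μ w * ∏ e ∈ E, (if hit w e then y e else x e)
      = (∏ e ∈ E, x e) *
          ∑ w, μ w * ∏ e ∈ E, (if hit w e then 1 - (1 - y e / x e) else 1) := by
        simp only [mul_sum, mul_left_comm (∏ e ∈ E, x e), ← prod_mul_distrib, mul_ite,
          sub_sub_cancel, hcancel, mul_one]
    _ ≤ (∏ e ∈ E, x e) * ∏ e ∈ E, (1 - p * (1 - y e / x e)) :=
        mul_le_mul_of_nonneg_left
          (sum_mul_prod_ite_one_sub_le hμ hμ1 hv hvp hvh
            (fun e => sub_nonneg.2 (div_le_one_of_le₀ (hyx e) (hx e)))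
            fun e => sub_le_self _ (div_nonneg (hy e) (hx e)))
          (prod_nonneg fun e _ => hx e)
    _ = ∏ e ∈ E, ((1 - p) * x e + p * y e) := by
        rw [← prod_mul_distrib]
        refine prod_congr rfl fun e _ => ?_
        linear_combination p * hcancel e

theorem iidMean_forall_card_hit_lt_le (hμ : 0 ≤ μ) (hμ1 : ∑ w, μ w = 1) (hv : Set.InjOn v E)
    (hvp : ∀ e ∈ E, (p : ℝ) ≤ μ (v e)) (hvh : ∀ e ∈ E, hit (v e) e) (N : ℕ) (d : ι → ℕ) :
    iidMean μ (fun w : Fin N → Ω => if ∀ e ∈ E, #{k | hit (w k) e} < d e then 1 else 0) ≤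
      ∏ e ∈ E, Bin(N, p).real (Set.Iio (d e)) := by
  induction N generalizing d with
  | zero =>
    have hdirac (e : ι) : Bin(0, p).real (Set.Iio (d e)) = if 0 < d e then 1 else 0 := by
      simp [binomial_zero, measureReal_def, Set.indicator_apply, apply_ite ENNReal.toReal]
    simp [iidMean, hdirac, prod_ite_zero]
  | succ N ih =>
    have hcons (s : Ω) (w : Fin N → Ω) (e : ι) :
        #{k | hit ((Fin.cons s w : Fin (N + 1) → Ω) k) e} < d e ↔
          #{k | hit (w k) e} < if hit s e then d e - 1 else d e := by
      rw [Fin.card_filter_univ_succ]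
      simp only [Fin.cons_zero, Fin.cons_succ]
      split_ifs <;> omega
    calc iidMean μ (fun w : Fin (N + 1) → Ω =>
            if ∀ e ∈ E, #{k | hit (w k) e} < d e then 1 else 0)
        = ∑ s, μ s * iidMean μ fun w : Fin N → Ω =>
            if ∀ e ∈ E, #{k | hit (w k) e} < if hit s e then d e - 1 else d e then 1 else 0 := by
          rw [iidMean_cons]
          simp only [hcons]
      _ ≤ ∑ s, μ s * ∏ e ∈ E, (if hit s e then Bin(N, p).real (Set.Iio (d e - 1))
            else Bin(N, p).real (Set.Iio (d e))) :=
          sum_le_sum fun s _ => mul_le_mul_of_nonneg_left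
            ((ih _).trans_eq (prod_congr rfl fun e _ => by split_ifs <;> rfl)) (hμ s)
      _ ≤ ∏ e ∈ E, ((1 - p) * Bin(N, p).real (Set.Iio (d e)) +
            p * Bin(N, p).real (Set.Iio (d e - 1))) :=
          sum_mul_prod_ite_le hμ hμ1 hv hvp hvh (fun e => measureReal_nonneg)
            fun e => measureReal_mono (Set.Iio_subset_Iio (Nat.sub_le _ _))
      _ = ∏ e ∈ E, Bin(N + 1, p).real (Set.Iio (d e)) :=
          prod_congr rfl fun e _ => (binomial_succ_real_Iio N (d e)).symm

end NegativeDependence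

section Cuts

variable {α β : Type*} [Fintype α] [DecidableEq α] [Fintype β] [DecidableEq β]

/-- The exchange of the roles of nodes and keys: instead of the set of keys of every node, record
the set of nodes holding every key. -/
def transposeAssignment (α β : Type*) [Fintype α] [DecidableEq α] [Fintype β] [DecidableEq β] :
    (α → Finset β) ≃ (β → Finset α) where
  toFun S k := {i | k ∈ S i}
  invFun N i := {k | i ∈ N k}
  left_inv S := by ext; simp
  right_inv N := by ext; simp

theorem mem_transposeAssignment {S : α → Finset β} {i : α} {k : β} :
    i ∈ transposeAssignment α β S k ↔ k ∈ S i := by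
  simp [transposeAssignment]

theorem card_inter_transposeAssignment (N : β → Finset α) (i j : α) :
    #(transposeAssignment β α N i ∩ transposeAssignment β α N j) =
      #{k | i ∈ N k ∧ j ∈ N k} := by
  congr 1
  ext k
  simp [mem_transposeAssignment]

theorem iidMean_bernoulliWeight_transposeAssignment (x : I) (f : (α → Finset β) → ℝ) :
    iidMean (bernoulliWeight x) f =
      iidMean (bernoulliWeight x) fun N : β → Finset α => f (transposeAssignment β α N) := by
  rw [iidMean, ← (transposeAssignment β α).sum_comp]
  refine sum_congr rfl fun N _ => ?_
  simp only [bernoulliWeight_eq_prod, mem_transposeAssignment]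
  rw [Finset.prod_comm]

theorem injOn_pair_product_compl (T : Finset α) :
    Set.InjOn (fun e : α × α => ({e.1, e.2} : Finset α)) (T ×ˢ Tᶜ : Finset (α × α)) := by
  rintro ⟨i, j⟩ he ⟨i', j'⟩ he' (h : ({i, j} : Finset α) = {i', j'})
  simp only [mem_coe, mem_product, mem_compl] at he he'
  rw [← coe_inj, coe_pair, coe_pair, Set.pair_eq_pair_iff] at h
  rcases h with ⟨rfl, rfl⟩ | ⟨rfl, rfl⟩
  · rfl
  · exact absurd he.1 he'.2

/- A key is held by exactly the two nodes of a pair with probability `x² (1 - x) ^ (card α - 2)`,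
and these events are disjoint for different pairs. -/
theorem iidMean_bernoulliWeight_forall_card_inter_lt_le (x : I) (P q : ℕ) (T : Finset α) :
    iidMean (bernoulliWeight x) (fun S : α → Finset (Fin P) =>
        if ∀ e ∈ T ×ˢ Tᶜ, #(S e.1 ∩ S e.2) < q then 1 else 0) ≤
      Bin(P, x ^ 2 * σ x ^ (Fintype.card α - 2)).real (Set.Iio q) ^ (#T * #Tᶜ) := by
  have hpair (e : α × α) (he : e ∈ T ×ˢ Tᶜ) :
      ((x ^ 2 * σ x ^ (Fintype.card α - 2) : I) : ℝ) ≤ bernoulliWeight x {e.1, e.2} := by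
    rw [mem_product, mem_compl] at he
    rw [bernoulliWeight, card_pair (ne_of_mem_of_not_mem he.1 he.2)]
    simp
  have hcover := iidMean_forall_card_hit_lt_le (hit := fun N e => e.1 ∈ N ∧ e.2 ∈ N)
    (bernoulliWeight_nonneg x) (sum_bernoulliWeight x) (injOn_pair_product_compl T) hpair
    (fun e _ => by simp) P fun _ => q
  rw [prod_const, card_product] at hcover
  rw [iidMean_bernoulliWeight_transposeAssignment]
  simp only [card_inter_transposeAssignment]
  convert hcover

end Cuts

section HalfSets

variable {α : Type*} [Fintype α]

/-- The nonempty sets containing at most half of the elements of `α`: every cut of `α` has such a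
side. -/
def halfSets (α : Type*) [Fintype α] : Finset (Finset α) :=
  {T | T.Nonempty ∧ 2 * #T ≤ Fintype.card α}

theorem exists_mem_halfSets_forall_not_adj_of_not_connected [Nonempty α] {G : SimpleGraph α}
    (hG : ¬ G.Connected) : ∃ T ∈ halfSets α, ∀ i ∈ T, ∀ j ∉ T, ¬ G.Adj i j := by
  classical
  obtain ⟨u, v, huv⟩ : ∃ u v, ¬ G.Reachable u v := by
    by_contra! h
    exact hG ⟨h⟩
  set C : Finset α := {w | G.Reachable u w} with hC
  have hadj (i : α) (hi : i ∈ C) (j : α) (hj : j ∉ C) : ¬ G.Adj i j := fun hij => by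
    simp only [hC, mem_filter_univ] at hi hj
    exact hj (hi.trans hij.reachable)
  obtain hcard | hcard := le_or_gt (2 * #C) (Fintype.card α)
  · exact ⟨C, mem_filter_univ _ |>.2 ⟨⟨u, by simp [hC]⟩, hcard⟩, hadj⟩
  · refine ⟨Cᶜ, mem_filter_univ _ |>.2 ⟨⟨v, by simpa [hC] using huv⟩, ?_⟩, fun i hi j hj hij => ?_⟩
    · rw [card_compl]
      omega
    · exact hadj j (by simpa using hj) i (by simpa using hi) hij.symm

theorem pow_mul_sub_le_exp {n r : ℕ} (hr : 2 * r ≤ n) {b t μ : ℝ} (ht : t ≤ 1) (hμ : 0 ≤ μ)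
    (hb0 : 0 ≤ b) (hb : b ≤ Real.exp (-μ)) :
    b ^ (r * (n - r)) ≤
      Real.exp (-(t * (μ * n))) ^ r + Real.exp (-((1 - t) / 2 * (μ * n) * n)) := by
  have hrn : 2 * (r : ℝ) ≤ n := by exact_mod_cast hr
  have hexp : b ^ (r * (n - r)) ≤ Real.exp (-(μ * (r * (n - r)))) := by
    calc b ^ (r * (n - r)) ≤ Real.exp (-μ) ^ (r * (n - r)) := pow_le_pow_left₀ hb0 hb _
      _ = Real.exp (-(μ * (r * (n - r)))) := by
        rw [← Real.exp_nat_mul, Nat.cast_mul, Nat.cast_sub (by omega)]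
        ring_nf
  obtain hsmall | hlarge := le_total (r : ℝ) ((1 - t) * n)
  · refine hexp.trans (le_add_of_le_of_nonneg ?_ (Real.exp_pos _).le)
    rw [← Real.exp_nat_mul, Real.exp_le_exp]
    have : μ * (r * (t * n)) ≤ μ * (r * (n - r)) := by gcongr; linarith
    linarith
  · refine hexp.trans (le_add_of_nonneg_of_le (by positivity) (Real.exp_le_exp.2 ?_))
    have : μ * ((1 - t) * n * (n / 2)) ≤ μ * (r * (n - r)) := by
      have := mul_nonneg (sub_nonneg.2 ht) n.cast_nonneg
      gcongr
      linarith
    linarith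

theorem sum_halfSets_pow_card_le {y : ℝ} (hy : 0 ≤ y) :
    ∑ T ∈ halfSets α, y ^ #T ≤ Real.exp (Fintype.card α * y) - 1 := by
  classical
  have hsub : halfSets α ⊆ univ.erase ∅ := fun T hT =>
    mem_erase.2 ⟨((mem_filter_univ T).1 hT).1.ne_empty, mem_univ T⟩
  calc ∑ T ∈ halfSets α, y ^ #T ≤ ∑ T ∈ univ.erase ∅, y ^ #T :=
        sum_le_sum_of_subset_of_nonneg hsub fun T _ _ => pow_nonneg hy _
    _ = (y + 1) ^ Fintype.card α - 1 := by
        rw [sum_erase_eq_sub (mem_univ ∅), ← Fintype.sum_pow_mul_eq_add_pow]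
        simp
    _ ≤ Real.exp (Fintype.card α * y) - 1 := by
        rw [Real.exp_nat_mul]
        gcongr
        exact Real.add_one_le_exp y

/- Small sets are counted with the weight `exp (-t μ n) ^ #T`; for sets with more than `(1 - t) n`
elements the trivial count `2 ^ n` suffices. -/
theorem sum_halfSets_pow_card_mul_card_compl_le [DecidableEq α] {b t μ : ℝ} (ht : t ≤ 1)
    (hμ : 0 ≤ μ) (hb0 : 0 ≤ b) (hb : b ≤ Real.exp (-μ)) :
    ∑ T ∈ halfSets α, b ^ (#T * #Tᶜ) ≤
      Real.exp (Fintype.card α * Real.exp (-(t * (μ * Fintype.card α)))) - 1 +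
        Real.exp (Fintype.card α * (Real.log 2 - (1 - t) / 2 * (μ * Fintype.card α))) := by
  have hcard : (#(halfSets α) : ℝ) ≤ 2 ^ Fintype.card α := by
    exact_mod_cast (card_le_univ _).trans_eq Fintype.card_finset
  calc ∑ T ∈ halfSets α, b ^ (#T * #Tᶜ)
      ≤ ∑ T ∈ halfSets α, (Real.exp (-(t * (μ * Fintype.card α))) ^ #T +
          Real.exp (-((1 - t) / 2 * (μ * Fintype.card α) * Fintype.card α))) := by
        refine sum_le_sum fun T hT => ?_
        rw [card_compl]
        exact pow_mul_sub_le_exp ((mem_filter_univ T).1 hT).2 ht hμ hb0 hb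
    _ = ∑ T ∈ halfSets α, Real.exp (-(t * (μ * Fintype.card α))) ^ #T +
          #(halfSets α) * Real.exp (-((1 - t) / 2 * (μ * Fintype.card α) * Fintype.card α)) := by
        rw [sum_add_distrib, sum_const, nsmul_eq_mul]
    _ ≤ Real.exp (Fintype.card α * Real.exp (-(t * (μ * Fintype.card α)))) - 1 +
          2 ^ Fintype.card α *
            Real.exp (-((1 - t) / 2 * (μ * Fintype.card α) * Fintype.card α)) := by
        gcongr
        exact sum_halfSets_pow_card_le (Real.exp_pos _).le
    _ = _ := by
        rw [mul_sub, sub_eq_add_neg (_ * Real.log 2), Real.exp_add, Real.exp_nat_mul (Real.log 2),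
          Real.exp_log two_pos]
        ring_nf

end HalfSets

section EdgeProbability

variable {t : ℝ}

theorem le_one_sub_pow_of_mul_le {x : ℝ} (hx : x ≤ 1) {n : ℕ} (h : n * x ≤ 1 - t) :
    t ≤ (1 - x) ^ n := by
  have := one_add_mul_le_pow (a := -x) (by linarith) n
  rw [← sub_eq_add_neg] at this
  linarith

theorem mul_pow_div_factorial_le_choose (ht0 : 0 ≤ t) {q P : ℕ} (hq : q ≤ (1 - t) * P) :
    (t * P) ^ q / q.factorial ≤ P.choose q := by
  have htP : 0 ≤ t * P := by positivity
  have hqP : q ≤ P := by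
    have : (q : ℝ) ≤ P := by linarith
    exact_mod_cast this
  refine le_trans ?_ (Nat.pow_le_choose q P)
  gcongr
  rw [Nat.cast_sub (by omega)]
  push_cast
  linarith

theorem binomial_real_Iio_le_exp {p : I} (ht0 : 0 ≤ t) {q P : ℕ} (hq : q ≤ (1 - t) * P)
    (hp : P * (p : ℝ) ≤ 1 - t) :
    Bin(P, p).real (Set.Iio q) ≤ Real.exp (-(t ^ (q + 1) / q.factorial * (P * p) ^ q)) := by
  have hp0 : (0 : ℝ) ≤ p := p.2.1
  have hfail : t ≤ (1 - p : ℝ) ^ (P - q) := by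
    refine le_one_sub_pow_of_mul_le p.2.2 (le_trans ?_ hp)
    gcongr
    exact Nat.sub_le _ _
  calc Bin(P, p).real (Set.Iio q) ≤ 1 - P.choose q * p ^ q * (1 - p) ^ (P - q) :=
        binomial_real_Iio_le P q
    _ ≤ 1 - (t * P) ^ q / q.factorial * p ^ q * t := by
        gcongr
        exact mul_pow_div_factorial_le_choose ht0 hq
    _ = 1 - t ^ (q + 1) / q.factorial * (P * p) ^ q := by ring
    _ ≤ _ := Real.one_sub_le_exp_neg _

theorem binomial_cover_real_Iio_le_exp (ht0 : 0 ≤ t) (ht1 : t ≤ 1) {n K P q : ℕ} (hP : 0 < P)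
    {x : I} (hx : P * (x : ℝ) = t * K) (hnK : n * K ≤ (1 - t) * P) (hKK : K ^ 2 ≤ (1 - t) * P)
    (hq : q ≤ (1 - t) * P) :
    Bin(P, x ^ 2 * σ x ^ (n - 2)).real (Set.Iio q) ≤
      Real.exp (-(t ^ (4 * q + 1) * (1 / q.factorial * (K ^ (2 * q) / P ^ q)))) := by
  have hP' : (0 : ℝ) < P := by exact_mod_cast hP
  have hx0 : (0 : ℝ) ≤ x := x.2.1
  have hxK : P * (x : ℝ) ^ 2 = t ^ 2 * (K ^ 2 / P) := by
    field_simp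
    linear_combination (P * x + t * K) * hx
  have hupper : P * ((x ^ 2 * σ x ^ (n - 2) : I) : ℝ) ≤ 1 - t :=
    calc P * ((x ^ 2 * σ x ^ (n - 2) : I) : ℝ) ≤ P * (x : ℝ) ^ 2 := by
          gcongr
          exact unitInterval.mul_le_left
      _ ≤ K ^ 2 / P := hxK.trans_le (mul_le_of_le_one_left (by positivity) (pow_le_one₀ ht0 ht1))
      _ ≤ 1 - t := (div_le_iff₀ hP').2 hKK
  have hlower : t ^ 3 * (K ^ 2 / P) ≤ P * ((x ^ 2 * σ x ^ (n - 2) : I) : ℝ) := by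
    have havoid : t ≤ (1 - x : ℝ) ^ (n - 2) := by
      refine le_one_sub_pow_of_mul_le x.2.2 (le_of_mul_le_mul_right ?_ hP')
      calc ((n - 2 : ℕ) : ℝ) * x * P ≤ n * x * P := by gcongr; exact Nat.sub_le _ _
        _ = t * (n * K) := by linear_combination n * hx
        _ ≤ n * K := mul_le_of_le_one_left (by positivity) ht1
        _ ≤ (1 - t) * P := hnK
    calc t ^ 3 * (K ^ 2 / P) = P * (x : ℝ) ^ 2 * t := by rw [hxK]; ring
      _ ≤ P * (x : ℝ) ^ 2 * (1 - x) ^ (n - 2) := by gcongr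
      _ = P * ((x ^ 2 * σ x ^ (n - 2) : I) : ℝ) := by simp [mul_assoc]
  refine (binomial_real_Iio_le_exp ht0 hq hupper).trans (Real.exp_le_exp.2 (neg_le_neg ?_))
  calc t ^ (4 * q + 1) * (1 / q.factorial * (K ^ (2 * q) / P ^ q))
      = t ^ (q + 1) / q.factorial * (t ^ 3 * (K ^ 2 / P)) ^ q := by
        rw [mul_pow, div_pow, ← pow_mul, ← pow_mul]
        ring
    _ ≤ _ := by gcongr

end EdgeProbability

section UnionBound

theorem monotone_indicator_one_of_isUpperSet {α : Type*} [Preorder α] {A : Set α}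
    (hA : IsUpperSet A) : Monotone (A.indicator (1 : α → ℝ)) := fun a b hab => by
  by_cases ha : a ∈ A
  · simp [ha, hA hab ha]
  · rw [Set.indicator_of_notMem ha]
    exact Set.indicator_nonneg (fun _ _ => zero_le_one) b

theorem measureReal_pi_eq_iidMean {ι Ω : Type*} [Fintype ι] [DecidableEq ι] [Fintype Ω]
    [MeasurableSpace Ω] [MeasurableSingletonClass Ω] (μ : Measure Ω) [IsFiniteMeasure μ]
    (A : Set (ι → Ω)) :
    (Measure.pi fun _ : ι => μ).real A = iidMean (fun s => μ.real {s}) (A.indicator 1) := by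
  classical
  rw [← Set.coe_toFinset A, ← sum_measureReal_singleton, iidMean]
  simp only [Set.coe_toFinset, Set.indicator_apply, Pi.one_apply, mul_ite, mul_one, mul_zero]
  rw [← sum_filter, Set.filter_mem_univ_eq_toFinset]
  refine sum_congr rfl fun S _ => ?_
  simp only [measureReal_def, Measure.pi_singleton, ENNReal.toReal_prod]

variable {q n K P : ℕ}

theorem isProbabilityMeasure_keyRingLaw (hK : K ≤ P) : IsProbabilityMeasure (keyRingLaw K P) := by
  refine isProbabilityMeasure_uniformOn (Set.toFinite _) ?_
  obtain ⟨S, hS⟩ := powersetCard_nonempty.2 (hK.trans_eq (card_fin P).symm)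
  exact ⟨S, mem_powersetCard_univ.1 hS⟩

theorem keyRingLaw_real_singleton (K P : ℕ) (S : Finset (Fin P)) :
    (keyRingLaw K P).real {S} = uniformWeight K S := by
  have hset : {S : Finset (Fin P) | #S = K} = (powersetCard K univ : Finset (Finset (Fin P))) := by
    ext
    simp
  rw [keyRingLaw, hset, ← coe_singleton, measureReal_def, uniformOn_apply_finset, uniformWeight]
  split_ifs with hS
  · simp [inter_singleton_of_mem (mem_powersetCard_univ.2 hS)]
  · simp [inter_singleton_of_notMem (mt mem_powersetCard_univ.1 hS)]

theorem connectedProb_eq_iidMean (q n : ℕ) (hK : K ≤ P) :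
    connectedProb q n K P =
      iidMean (uniformWeight K)
        ({S : Fin n → Finset (Fin P) | (qCompositeGraph q S).Connected}.indicator 1) := by
  have := isProbabilityMeasure_keyRingLaw hK
  rw [connectedProb, keyAssignmentLaw, measureReal_pi_eq_iidMean]
  simp only [keyRingLaw_real_singleton]

theorem connectedProb_le_one (q n : ℕ) (hK : K ≤ P) : connectedProb q n K P ≤ 1 := by
  have := isProbabilityMeasure_keyRingLaw hK
  rw [connectedProb, keyAssignmentLaw]
  exact measureReal_le_one

theorem qCompositeGraph_mono (q : ℕ) :
    Monotone fun S : Fin n → Finset (Fin P) => qCompositeGraph q S := fun _ _ hS i j hij =>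
  ⟨hij.1, hij.2.trans (card_le_card (inter_subset_inter (hS i) (hS j)))⟩

theorem isUpperSet_setOf_connected_qCompositeGraph (q : ℕ) :
    IsUpperSet {S : Fin n → Finset (Fin P) | (qCompositeGraph q S).Connected} :=
  fun _ _ hS hconn => hconn.mono (qCompositeGraph_mono q hS)

theorem one_sub_sum_sub_sum_le_indicator_connected [NeZero n] (S : Fin n → Finset (Fin P)) :
    1 - ∑ i, (if K < #(S i) then 1 else 0) -
        ∑ T ∈ halfSets (Fin n), (if ∀ e ∈ T ×ˢ Tᶜ, #(S e.1 ∩ S e.2) < q then 1 else 0) ≤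
      if ∀ i, #(S i) ≤ K then
        ({S : Fin n → Finset (Fin P) | (qCompositeGraph q S).Connected}.indicator 1 S : ℝ)
      else 0 := by
  have hbig (i : Fin n) : (0 : ℝ) ≤ if K < #(S i) then 1 else 0 := by positivity
  have hcut (T : Finset (Fin n)) :
      (0 : ℝ) ≤ if ∀ e ∈ T ×ˢ Tᶜ, #(S e.1 ∩ S e.2) < q then 1 else 0 := by positivity
  have hbig0 := sum_nonneg fun i (_ : i ∈ univ) => hbig i
  have hcut0 := sum_nonneg fun T (_ : T ∈ halfSets (Fin n)) => hcut T
  split_ifs with hS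
  · by_cases hconn : S ∈ {S : Fin n → Finset (Fin P) | (qCompositeGraph q S).Connected}
    · rw [Set.indicator_of_mem hconn, Pi.one_apply]
      linarith
    · obtain ⟨T, hT, hadj⟩ := exists_mem_halfSets_forall_not_adj_of_not_connected hconn
      have hempty : ∀ e ∈ T ×ˢ Tᶜ, #(S e.1 ∩ S e.2) < q := fun e he => by
        rw [mem_product, mem_compl] at he
        exact not_le.1 fun h => hadj _ he.1 _ he.2 ⟨ne_of_mem_of_not_mem he.1 he.2, h⟩
      have := single_le_sum (fun T _ => hcut T) hT
      rw [if_pos hempty] at this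
      rw [Set.indicator_of_notMem hconn]
      linarith
  · push Not at hS
    obtain ⟨i, hi⟩ := hS
    have := single_le_sum (fun i _ => hbig i) (mem_univ i)
    rw [if_pos hi] at this
    linarith

theorem one_sub_connectedProb_le [NeZero n] (hK : K ≤ P) (x : I) :
    1 - connectedProb q n K P ≤
      n * ∑ S : Finset (Fin P) with K < #S, bernoulliWeight x S +
        ∑ T ∈ halfSets (Fin n), Bin(P, x ^ 2 * σ x ^ (n - 2)).real (Set.Iio q) ^ (#T * #Tᶜ) := by
  set w : Finset (Fin P) → ℝ := bernoulliWeight x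
  have hw : 0 ≤ w := bernoulliWeight_nonneg x
  have hw1 : ∑ S, w S = 1 := sum_bernoulliWeight x
  set big : (Fin n → Finset (Fin P)) → ℝ := fun S => ∑ i, if K < #(S i) then 1 else 0
  set cut : Finset (Fin n) → (Fin n → Finset (Fin P)) → ℝ := fun T S =>
    if ∀ e ∈ T ×ˢ Tᶜ, #(S e.1 ∩ S e.2) < q then 1 else 0
  have hmean : iidMean w (fun S => 1 - big S - ∑ T ∈ halfSets (Fin n), cut T S) =
      1 - n * (∑ S with K < #S, w S) - ∑ T ∈ halfSets (Fin n), iidMean w (cut T) := by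
    rw [iidMean_sub, iidMean_sub, iidMean_one hw1, iidMean_sum, iidMean_sum]
    simp only [iidMean_eval hw1 fun S => if K < #S then 1 else 0]
    simp [sum_filter]
  have hconn : iidMean w (fun S => 1 - big S - ∑ T ∈ halfSets (Fin n), cut T S) ≤
      connectedProb q n K P := by
    refine (iidMean_mono hw one_sub_sum_sub_sum_le_indicator_connected).trans ?_
    rw [← iidMean_ite_zero w fun S => #S ≤ K, connectedProb_eq_iidMean q n hK]
    refine (stochDominated_bernoulliWeight_uniformWeight x (by simpa using hK)).iidMean_le
      (fun S => ite_nonneg (hw S) le_rfl) (uniformWeight_nonneg K)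
      (monotone_indicator_one_of_isUpperSet (isUpperSet_setOf_connected_qCompositeGraph q))
      (fun _ => Set.indicator_nonneg (fun _ _ => zero_le_one) _)
  have hcuts : ∑ T ∈ halfSets (Fin n), iidMean w (cut T) ≤
      ∑ T ∈ halfSets (Fin n), Bin(P, x ^ 2 * σ x ^ (n - 2)).real (Set.Iio q) ^ (#T * #Tᶜ) :=
    sum_le_sum fun T _ => by
      have hT := iidMean_bernoulliWeight_forall_card_inter_lt_le (α := Fin n) x P q T
      rw [Fintype.card_fin] at hT
      convert hT
  linarith

theorem one_sub_connectedProb_le_exp [NeZero n] {t L : ℝ} (ht0 : 0 < t) (ht1 : t < 1)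
    (hK : 0 < K) (hqn : q ≤ n) (hnK : n * K ≤ (1 - t) * P) (hKK : K ^ 2 ≤ (1 - t) * P)
    (hL0 : 0 ≤ L)
    (hL : L / n ≤ t ^ (4 * q + 1) * (1 / q.factorial * (K ^ (2 * q) / P ^ q))) :
    1 - connectedProb q n K P ≤
      n * Real.exp (-((1 - t) ^ 2 / 4 * K)) +
        (Real.exp (n * Real.exp (-(t * L))) - 1 +
          Real.exp (n * (Real.log 2 - (1 - t) / 2 * L))) := by
  have hK1 : (1 : ℝ) ≤ K := by exact_mod_cast hK
  have hP : 0 < (P : ℝ) := by nlinarith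
  have hq : q ≤ (1 - t) * P := by
    have : (q : ℝ) ≤ n := by exact_mod_cast hqn
    nlinarith
  have hKP : (K : ℝ) ≤ P := by nlinarith
  set x : I := ⟨t * K / P, by positivity, (div_le_one hP).2 (by nlinarith)⟩
  have hPx : P * (x : ℝ) = t * K := mul_div_cancel₀ _ hP.ne'
  have hbig := sum_bernoulliWeight_card_gt_le_exp_of_mean (α := Fin P) ht0.le ht1.le
    ((Fintype.card_fin P).symm ▸ hPx)
  have hcover := binomial_cover_real_Iio_le_exp ht0.le ht1.le (by exact_mod_cast hP) hPx hnK hKK hq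
  have hcuts := sum_halfSets_pow_card_mul_card_compl_le (α := Fin n) ht1.le (by positivity)
    measureReal_nonneg (hcover.trans (Real.exp_le_exp.2 (neg_le_neg hL)))
  rw [Fintype.card_fin, div_mul_cancel₀ L (NeZero.ne _)] at hcuts
  refine (one_sub_connectedProb_le (by exact_mod_cast hKP) x).trans ?_
  gcongr

end UnionBound

section Asymptotics

theorem exists_one_lt_pow_mul {c : ℝ} (hc : 1 < c) (m : ℕ) :
    ∃ t : ℝ, 0 < t ∧ t < 1 ∧ 1 < t ^ m * c := by
  have hlim : Tendsto (fun t : ℝ => t ^ m * c) (𝓝[<] 1) (𝓝 c) := by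
    have : ContinuousAt (fun t : ℝ => t ^ m * c) 1 := by fun_prop
    simpa [ContinuousAt] using this.mono_left nhdsWithin_le_nhds
  have hIoo : ∀ᶠ t : ℝ in 𝓝[<] 1, t ∈ Set.Ioo 0 1 := Ioo_mem_nhdsLT one_pos
  obtain ⟨t, htc, ht⟩ := ((hlim.eventually (lt_mem_nhds hc)).and hIoo).exists
  exact ⟨t, ht.1, ht.2, htc⟩

section KeySize

variable {K P : ℕ → ℕ}

theorem isLittleO_sq_of_isLittleO_min_sqrt_div
    (h : (fun n => (K n : ℝ)) =o[atTop] fun n => min √(P n : ℝ) (P n / n)) :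
    (fun n => (K n : ℝ) ^ 2) =o[atTop] fun n => (P n : ℝ) := by
  have hsqrt : (fun n => (K n : ℝ)) =o[atTop] fun n => √(P n : ℝ) := h.trans_le fun n => by
    rw [Real.norm_of_nonneg (by positivity), Real.norm_of_nonneg (by positivity)]
    exact min_le_left _ _
  simpa using hsqrt.pow two_pos

theorem isLittleO_natCast_mul_of_isLittleO_min_sqrt_div
    (h : (fun n => (K n : ℝ)) =o[atTop] fun n => min √(P n : ℝ) (P n / n)) :
    (fun n => n * (K n : ℝ)) =o[atTop] fun n => (P n : ℝ) := by
  have hdiv : (fun n => (K n : ℝ)) =o[atTop] fun n => (P n / n : ℝ) := h.trans_le fun n => by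
    rw [Real.norm_of_nonneg (by positivity), Real.norm_of_nonneg (by positivity)]
    exact min_le_right _ _
  refine ((isBigO_refl (fun n : ℕ => (n : ℝ)) atTop).mul_isLittleO hdiv).congr' .rfl ?_
  filter_upwards [eventually_ne_atTop 0] with n hn
  exact mul_div_cancel₀ _ (Nat.cast_ne_zero.2 hn)

theorem eventually_sq_le_and_natCast_mul_le
    (h : (fun n => (K n : ℝ)) =o[atTop] fun n => min √(P n : ℝ) (P n / n)) {ε : ℝ} (hε : 0 < ε) :
    ∀ᶠ n in atTop, (K n : ℝ) ^ 2 ≤ ε * P n ∧ n * (K n : ℝ) ≤ ε * P n := by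
  filter_upwards [(isLittleO_sq_of_isLittleO_min_sqrt_div h).bound hε,
    (isLittleO_natCast_mul_of_isLittleO_min_sqrt_div h).bound hε] with n hsq hmul
  rw [RCLike.norm_natCast] at hsq hmul
  exact ⟨(Real.le_norm_self _).trans hsq, (Real.le_norm_self _).trans hmul⟩

theorem eventually_pos_of_log_isLittleO
    (hK : (fun n : ℕ => Real.log n) =o[atTop] fun n => (K n : ℝ)) :
    ∀ᶠ n in atTop, 0 < K n := by
  filter_upwards [hK.isBigO.eq_zero_imp, eventually_ge_atTop 2] with n hzero hn
  refine Nat.pos_of_ne_zero fun hKn => ?_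
  exact (Real.log_pos (by exact_mod_cast hn)).ne' (hzero (by simp [hKn]))

theorem tendsto_mul_exp_neg_of_log_isLittleO
    (hK : (fun n : ℕ => Real.log n) =o[atTop] fun n => (K n : ℝ)) {ε : ℝ} (hε : 0 < ε) :
    Tendsto (fun n : ℕ => n * Real.exp (-(ε * K n))) atTop (𝓝 0) := by
  refine squeeze_zero' (.of_forall fun n => by positivity) ?_ tendsto_inv_atTop_nhds_zero_nat
  filter_upwards [hK.bound (half_pos hε), eventually_gt_atTop 0] with n hlog hn
  have hn' : (0 : ℝ) < n := by exact_mod_cast hn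
  have hlog' : 2 * Real.log n ≤ ε * K n := by
    rw [RCLike.norm_natCast] at hlog
    linarith [Real.le_norm_self (Real.log n)]
  calc n * Real.exp (-(ε * K n)) ≤ n * Real.exp (-(2 * Real.log n)) := by gcongr
    _ = (n : ℝ)⁻¹ := by
      rw [two_mul, neg_add, Real.exp_add, Real.exp_neg, Real.exp_log hn']
      field_simp

theorem eventually_le_of_isLittleO_min_sqrt_div
    (h : (fun n => (K n : ℝ)) =o[atTop] fun n => min √(P n : ℝ) (P n / n)) :
    ∀ᶠ n in atTop, K n ≤ P n := by
  filter_upwards [eventually_sq_le_and_natCast_mul_le h one_pos] with n hn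
  rw [one_mul] at hn
  exact (Nat.le_self_pow two_ne_zero _).trans (by exact_mod_cast hn.1)

theorem eventually_one_sub_connectedProb_le_exp {q : ℕ} {c t : ℝ} (ht0 : 0 < t) (ht1 : t < 1)
    (hc : 0 ≤ c) (hK : (fun n : ℕ => Real.log n) =o[atTop] fun n => (K n : ℝ))
    (hKP : (fun n => (K n : ℝ)) =o[atTop] fun n => min √(P n : ℝ) (P n / n))
    (hedge : ∀ᶠ n : ℕ in atTop,
      c * Real.log n / n ≤ 1 / q.factorial * ((K n : ℝ) ^ (2 * q) / P n ^ q)) :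
    ∀ᶠ n : ℕ in atTop, 1 - connectedProb q n (K n) (P n) ≤
      n * Real.exp (-((1 - t) ^ 2 / 4 * K n)) +
        (Real.exp (n * Real.exp (-(t * (t ^ (4 * q + 1) * c * Real.log n)))) - 1 +
          Real.exp (n * (Real.log 2 - (1 - t) / 2 * (t ^ (4 * q + 1) * c * Real.log n)))) := by
  filter_upwards [eventually_sq_le_and_natCast_mul_le hKP (sub_pos.2 ht1), hedge,
    eventually_pos_of_log_isLittleO hK, eventually_ge_atTop q, eventually_ne_atTop 0]
    with n ⟨hKK, hnK⟩ hedge hK hqn hn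
  have : NeZero n := ⟨hn⟩
  refine one_sub_connectedProb_le_exp ht0 ht1 hK hqn hnK hKK
    (mul_nonneg (by positivity) (Real.log_natCast_nonneg n)) ?_
  rw [mul_assoc, mul_div_assoc]
  gcongr

end KeySize

theorem tendsto_exp_mul_exp_sub_one_add_exp {a t : ℝ} (ht0 : 0 < t) (ht1 : t < 1)
    (hta : 1 < t * a) :
    Tendsto (fun n : ℕ => Real.exp (n * Real.exp (-(t * (a * Real.log n)))) - 1 +
      Real.exp (n * (Real.log 2 - (1 - t) / 2 * (a * Real.log n)))) atTop (𝓝 0) := by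
  have ha : 0 < a := pos_of_mul_pos_right (one_pos.trans hta) ht0.le
  have hlog : Tendsto (fun n : ℕ => Real.log n) atTop atTop :=
    Real.tendsto_log_atTop.comp tendsto_natCast_atTop_atTop
  have hsmall : Tendsto (fun n : ℕ => n * Real.exp (-(t * (a * Real.log n)))) atTop (𝓝 0) := by
    refine (Real.tendsto_exp_neg_atTop_nhds_zero.comp
      (hlog.const_mul_atTop (sub_pos.2 hta))).congr' ?_
    filter_upwards [eventually_gt_atTop 0] with n hn
    have hn' : (0 : ℝ) < n := by exact_mod_cast hn
    rw [Function.comp_apply, ← Real.exp_log hn', ← Real.exp_add, Real.log_exp]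
    ring_nf
  have hlarge : Tendsto (fun n : ℕ => n * (Real.log 2 - (1 - t) / 2 * (a * Real.log n))) atTop
      atBot := by
    refine tendsto_natCast_atTop_atTop.atTop_mul_atBot₀ ?_
    simp only [sub_eq_add_neg (Real.log 2)]
    exact tendsto_atBot_add_const_left _ _ (tendsto_neg_atTop_atBot.comp
      ((hlog.const_mul_atTop ha).const_mul_atTop (by linarith)))
  simpa using ((Real.continuous_exp.tendsto 0).comp hsmall |>.sub_const 1).add
    (Real.tendsto_exp_atBot.comp hlarge)

end Asymptotics

theorem theorem1 (q : ℕ) (hq : 1 ≤ q) (K P : ℕ → ℕ)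
    (hK : (fun n : ℕ => Real.log (n : ℝ)) =o[atTop] (fun n : ℕ => (K n : ℝ)))
    (hKP : (fun n : ℕ => (K n : ℝ)) =o[atTop]
      (fun n : ℕ => min (Real.sqrt (P n : ℝ)) ((P n : ℝ) / (n : ℝ))))
    (c : ℝ) (hc : 1 < c)
    (hedge : ∀ᶠ n : ℕ in atTop,
      c * Real.log (n : ℝ) / (n : ℝ) ≤
        1 / (q.factorial : ℝ) * ((K n : ℝ) ^ (2 * q) / (P n : ℝ) ^ q)) :
    Tendsto (fun n : ℕ => connectedProb q n (K n) (P n)) atTop (𝓝 1) := by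
  obtain ⟨t, ht0, ht1, htc⟩ := exists_one_lt_pow_mul hc (4 * q + 2)
  have hta : 1 < t * (t ^ (4 * q + 1) * c) := htc.trans_eq (by ring)
  have hrate : 0 < (1 - t) ^ 2 / 4 := by nlinarith
  have hbound := eventually_one_sub_connectedProb_le_exp ht0 ht1 (zero_le_one.trans hc.le) hK hKP
    hedge
  have hle : ∀ᶠ n in atTop, connectedProb q n (K n) (P n) ≤ 1 :=
    (eventually_le_of_isLittleO_min_sqrt_div hKP).mono fun n => connectedProb_le_one q n
  have hlim := ((tendsto_mul_exp_neg_of_log_isLittleO hK hrate).add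
    (tendsto_exp_mul_exp_sub_one_add_exp ht0 ht1 hta)).const_sub 1
  rw [add_zero, sub_zero] at hlim
  exact tendsto_of_tendsto_of_tendsto_of_le_of_le' hlim tendsto_const_nhds
    (hbound.mono fun n => sub_le_comm.1) hle
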